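/- A (Čech) closure space is a set $X$ with a map $c:2^X\to 2^X$ such that $c(\varnothing)=\varnothing$, $A\subset c(A)$ and $c(A\cup B)=c(A)\cup c(B)$ for all $A,B\subset X$. A map $f:(X,c)\to(Y,d)$ is continuous if $f(c(A))\subset d(f(A))$ for all $A\subset X$. A topological space is regarded as a closure space through its topological closure operator. The singular homology $H_k(X,c)$ is the $k$-th homology group of the chain complex whose $n$-th group $C_n(X,c)$ is the free abelian group on the continuous maps $\sigma:|\Delta^n|\to (X,c)$, where $|\Delta^n|=\{t\in\mathbb{R}^{n+1}\mid t_i\ge 0,\ \sum_i t_i=1\}$ has the Euclidean topology, with boundary map $\partial_n\sigma=\sum_{i=0}^n(-1)^i\,\sigma|_{[e_0,\dots,\hat e_i,\dots,e_n]}$. For integers $n,m\ge 0$ let $\mathbb{Z}_n=\{0,1,\dots,n-1\}$ with the distance $d(i,j)=\min\{|k| : k\in\mathbb{Z},\ k\equiv i-j \pmod n\}$, and let $c_m$ be the closure operator on $\mathbb{Z}_n$ given by $c_m(A)=\bigcup_{i\in A}\{j\in\mathbb{Z}_n\mid d(i,j)\le m\}$. Theorem. Let $n,m\ge 0$ be integers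 with $n\ge 4m$. Then $H_k(\mathbb{Z}_n,c_m)=0$ for all $k\ge 2$. -/

import Mathlib

open CategoryTheory

/-- A Čech closure operator on a set `X`; the pair of `X` and the operator is a (Čech) closure
space. Idempotency is not required. -/
structure CechClosure (X : Type*) where
  /-- the closure of a subset -/
  cl : Set X → Set X
  cl_empty : cl ∅ = ∅
  subset_cl : ∀ A, A ⊆ cl A
  cl_union : ∀ A B, cl (A ∪ B) = cl A ∪ cl B

namespace CechClosure

/-- A map of closure spaces is continuous if `f (c A) ⊆ d (f A)` for every subset `A`. -/
def IsContinuous {X Y : Type*} (c : CechClosure X) (d : CechClosure Y) (f : X → Y) : Prop :=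
  ∀ A : Set X, f '' c.cl A ⊆ d.cl (f '' A)

theorem IsContinuous.comp {X Y Z : Type*} {c : CechClosure X} {d : CechClosure Y}
    {e : CechClosure Z} {g : Y → Z} {f : X → Y} (hg : IsContinuous d e g)
    (hf : IsContinuous c d f) : IsContinuous c e (g ∘ f) := by
  intro A
  rw [Set.image_comp, Set.image_comp]
  exact (Set.image_mono (hf A)).trans (hg _)

/-- The (Kuratowski) closure operator of a topological space. -/
def ofTopology (X : Type*) [TopologicalSpace X] : CechClosure X where
  cl := closure
  cl_empty := closure_empty
  subset_cl _ := subset_closure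
  cl_union _ _ := closure_union

theorem isContinuous_of_continuous {X Y : Type*} [TopologicalSpace X] [TopologicalSpace Y]
    {f : X → Y} (hf : Continuous f) : IsContinuous (ofTopology X) (ofTopology Y) f :=
  fun _ => image_closure_subset_closure_image hf

/-- The singular `n`-simplices of a closure space: continuous maps to it from the standard simplex
`|Δⁿ|`, which carries the subspace topology of `ℝⁿ⁺¹`. -/
abbrev SingularSimplex {X : Type} (c : CechClosure X) (n : ℕ) : Type :=
  {σ : stdSimplex ℝ (Fin (n + 1)) → X //
    IsContinuous (ofTopology (stdSimplex ℝ (Fin (n + 1)))) c σ}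

/-- The singular simplicial set of a closure space. A monotone map `f` acts by precomposition with
the affine map of standard simplices that sends the vertex `e_i` to `e_(f i)`; in particular, the
`i`-th face of `σ` is its restriction to the face of `|Δⁿ|` opposite to the vertex `e_i`. -/
noncomputable def singularSet {X : Type} (c : CechClosure X) : SSet.{0} where
  obj n := SingularSimplex c n.unop.len
  map f := ↾fun σ => ⟨σ.1 ∘ stdSimplex.map f.unop.toOrderHom,
    σ.2.comp (isContinuous_of_continuous (stdSimplex.continuous_map _))⟩
  map_id n := by
    refine ConcreteCategory.hom_ext _ _ fun σ => Subtype.ext ?_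
    change σ.1 ∘ stdSimplex.map id = σ.1
    funext x
    simp [stdSimplex.map_id_apply]
  map_comp f g := by
    refine ConcreteCategory.hom_ext _ _ fun σ => Subtype.ext ?_
    change σ.1 ∘ stdSimplex.map (f.unop.toOrderHom ∘ g.unop.toOrderHom) =
      (σ.1 ∘ stdSimplex.map f.unop.toOrderHom) ∘ stdSimplex.map g.unop.toOrderHom
    funext x
    simp [stdSimplex.map_comp_apply]

/-- The singular chain complex of a closure space: in degree `n` the free `ℤ`-module on the
singular `n`-simplices, with differential the alternating sum of the faces. -/
noncomputable def singularChainComplex {X : Type} (c : CechClosure X) :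
    ChainComplex (ModuleCat.{0} ℤ) ℕ :=
  (AlgebraicTopology.alternatingFaceMapComplex (ModuleCat.{0} ℤ)).obj
    (((SimplicialObject.whiskering _ _).obj (ModuleCat.free ℤ)).obj (singularSet c))

/-- The `k`-th singular homology group of a closure space, with integer coefficients. -/
noncomputable def singularHomology {X : Type} (c : CechClosure X) (k : ℕ) : ModuleCat.{0} ℤ :=
  (singularChainComplex c).homology k

end CechClosure

/-- The cyclic distance on `ℤ_n = {0, …, n - 1}`: the least absolute value of an integer congruent
to `i - j` modulo `n`. -/
noncomputable def cyclicDist (n : ℕ) (i j : Fin n) : ℕ :=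
  sInf {a : ℕ | ∃ k : ℤ, k ≡ (i : ℤ) - (j : ℤ) [ZMOD n] ∧ k.natAbs = a}

theorem cyclicDist_self (n : ℕ) (i : Fin n) : cyclicDist n i i = 0 :=
  Nat.le_zero.mp (Nat.sInf_le ⟨0, by simp [Int.ModEq.refl], rfl⟩)

/-- The closure operator `c_m` on `ℤ_n`, which adds to a set all points at cyclic distance at
most `m` from one of its points. -/
def rootsOfUnityClosure (n m : ℕ) : CechClosure (Fin n) where
  cl A := ⋃ i ∈ A, {j | cyclicDist n i j ≤ m}
  cl_empty := by simp
  subset_cl A i hi := Set.mem_biUnion hi (by simp [cyclicDist_self])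
  cl_union A B := Set.biUnion_union A B _

/-!
The reduction map from `ℤ` with the closure operator `c_m` to `(ℤ_n, c_m)` behaves like the universal
covering of a circle. If `3 * m < n`, a continuous map from a contractible space to `ℤ_n` has a
continuous lift to `ℤ` (`exists_lift_intClosure`): near each point there is a lift that stays within
`m` of a chosen value, and the differences of these local lifts form a locally constant cocycle,
which is a coboundary because coverings of contractible spaces have sections. Lifts are unique up to
translation by multiples of `n` (`eq_add_of_lifts`). So the translation `t` by `n` acts freely on the
singular simplices of `ℤ`, those of `ℤ_n` are the orbits, and
`0 → C(ℤ) → C(ℤ) → C(ℤ_n) → 0`, with first map `t - 1`, is a short exact sequence of chain complexes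
(`shortExact_intToFin`). Thus `H_k(ℤ_n)` lies between `H_k(ℤ)` and `H_{k-1}(ℤ)` in an exact sequence.

For `m ≥ 1` the closure space `(ℤ, c_m)` is contractible: truncating to `[-N, N]` with `N` decreasing
from `∞` to `0` moves points by steps of size one (`intClosureDeformation`). A contraction turns a
singular simplex into a singular simplex on its cone, and these cones are an extra degeneracy of the
singular simplicial set, so the homology vanishes in positive degrees
(`DiscreteDeformation.subsingleton_singularHomology`); hence `H_k(ℤ_n) = 0` for `k ≥ 2`. For `m = 0`
all singular simplices of `ℤ_n` are constant, and the same cone argument, over a discrete set instead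
of a point, applies to `ℤ_n` itself.
-/

/-! ### Closure operators given by relations -/

namespace CechClosure

/-- The closure operator that adds to a set every point related to one of its points. Both
`rootsOfUnityClosure` and its analogue on `ℤ` are of this form by definition. -/
def ofRel {X : Type*} (r : X → X → Prop) (hr : ∀ x, r x x) : CechClosure X where
  cl A := ⋃ i ∈ A, {j | r i j}
  cl_empty := by simp
  subset_cl A i hi := Set.mem_biUnion hi (hr i)
  cl_union A B := Set.biUnion_union A B _

/-- Continuity into a closure space given by a relation is a local condition at each point. -/
theorem isContinuous_ofRel_iff {T X : Type*} [TopologicalSpace T] {r : X → X → Prop}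
    {hr : ∀ x, r x x} {f : T → X} :
    IsContinuous (ofTopology T) (ofRel r hr) f ↔ ∀ x, ∀ᶠ y in nhds x, r (f y) (f x) := by
  constructor
  · intro h x
    by_contra hx
    have hcl : x ∈ closure {y | ¬ r (f y) (f x)} :=
      mem_closure_iff_frequently.2 fun h => hx (h.mono fun _ => not_not.1)
    have := h {y | ¬ r (f y) (f x)} ⟨x, hcl, rfl⟩
    simp only [ofRel, Set.mem_iUnion, Set.mem_image, Set.mem_ofPred_eq] at this
    obtain ⟨_, ⟨y, hy, rfl⟩, hr'⟩ := this
    exact hy hr'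
  · rintro h A _ ⟨x, hx, rfl⟩
    obtain ⟨y, hyA, hy⟩ := ((mem_closure_iff_frequently.1 hx).and_eventually (h x)).exists
    exact Set.mem_biUnion ⟨y, hyA, rfl⟩ hy

end CechClosure

/-! ### Cocycles on contractible spaces -/

open Topology Bundle in
/-- A locally constant cocycle on an open cover of a contractible space is a coboundary: it glues
trivial coverings to a covering, which has a section. -/
theorem exists_coboundary_of_contractible {T ι A : Type} [TopologicalSpace T] [ContractibleSpace T]
    [AddCommGroup A] (U : ι → Set T) (hU : ∀ i, IsOpen (U i)) (ix : T → ι)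
    (hix : ∀ x, x ∈ U (ix x)) (a : ι → ι → T → A)
    (ha : ∀ i j k, ∀ x ∈ U i ∩ U j ∩ U k, a i j x + a j k x = a i k x)
    (hloc : ∀ i j, ∀ x ∈ U i ∩ U j, ∀ᶠ y in 𝓝 x, a i j y = a i j x) :
    ∃ b : ι → T → A, (∀ i j, ∀ x ∈ U i ∩ U j, b i x + a i j x = b j x) ∧
      ∀ i, ∀ x ∈ U i, ∀ᶠ y in 𝓝 x, b i y = b i x := by
  -- the fibre carries the discrete topology, so that the bundle below is a covering
  let tA : TopologicalSpace A := ⊥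
  have dA : DiscreteTopology A := ⟨rfl⟩
  let Z : FiberBundleCore ι T A :=
    { baseSet := U
      isOpen_baseSet := hU
      indexAt := ix
      mem_baseSet_at := hix
      coordChange := fun i j x v => v + a i j x
      coordChange_self := fun i x hx v => by
        have := ha i i i x ⟨⟨hx, hx⟩, hx⟩
        simpa using this
      continuousOn_coordChange := fun i j => by
        rintro ⟨x, v⟩ ⟨hx, -⟩
        refine ContinuousAt.continuousWithinAt ?_
        have h1 : ∀ᶠ p : T × A in 𝓝 (x, v), a i j p.1 = a i j x :=
          (continuousAt_fst (p := (x, v))).eventually (hloc i j x hx)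
        have h2 : ∀ᶠ p : T × A in 𝓝 (x, v), p.2 = v :=
          (continuousAt_snd (p := (x, v))).eventually
            (p := fun w => w = v) (by simp [nhds_discrete])
        refine (continuousAt_const (y := v + a i j x)).congr ?_
        filter_upwards [h1, h2] with p hp1 hp2
        rw [hp1, hp2]
      coordChange_comp := fun i j k x hx v => by
        rw [add_assoc, ha i j k x hx] }
  have cov : IsCoveringMap (π A Z.Fiber) := FiberBundle.isCoveringMap (F := A)
  -- lifting a contraction, read as a homotopy from a constant map to the identity, ends in a section
  obtain ⟨x₀, ⟨H⟩⟩ := (contractible_iff_id_nullhomotopic T).1 ‹_›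
  let e₀ : TotalSpace A Z.Fiber := ⟨x₀, (0 : A)⟩
  let G := cov.liftHomotopy (H.symm : C(unitInterval × T, T)) (ContinuousMap.const T e₀)
    (fun t => by simp [e₀])
  have hG : ∀ p, (G p).proj = H.symm p := fun p =>
    congrFun (cov.liftHomotopy_lifts (H.symm : C(unitInterval × T, T)) (ContinuousMap.const T e₀)
      (fun t => by simp [e₀])) p
  let s : T → TotalSpace A Z.Fiber := fun x => G (1, x)
  have hs : Continuous s := G.continuous.comp (by fun_prop)
  have hsp : ∀ x, (s x).proj = x := fun x => by simp [s, hG]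
  refine ⟨fun i x => (Z.localTriv i (s x)).2, fun i j x hx => ?_, fun i x hx => ?_⟩
  · have := Z.coordChange_comp (Z.indexAt (s x).proj) i j x
      ⟨⟨by rw [hsp]; exact hix x, hx.1⟩, hx.2⟩ (s x).2
    simpa [Z, hsp] using this
  · have hmem : s x ∈ (Z.localTriv i).source := by
      rw [Z.mem_localTriv_source, hsp]; exact hx
    have hc : ContinuousAt (fun y => (Z.localTriv i (s y)).2) x :=
      continuousAt_snd.comp
        (((Z.localTriv i).continuousAt hmem).comp hs.continuousAt)
    have := hc.eventually (p := fun v => v = (Z.localTriv i (s x)).2) (by simp [nhds_discrete])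
    exact this

/-! ### Lifting from `ℤ_n` to `ℤ` -/

/-- The integers with the closure operator that adds to a set all points at distance at most `m`
from one of its points. -/
def intClosure (m : ℕ) : CechClosure ℤ :=
  CechClosure.ofRel (fun i j => |i - j| ≤ m) (by simp)

/-- Reduction modulo `n`, with values in `{0, …, n - 1}`. -/
def intToFin (n : ℕ) [NeZero n] (x : ℤ) : Fin n :=
  ⟨(x % n).toNat, by
    have hn : (0 : ℤ) < n := by exact_mod_cast NeZero.pos n
    have := Int.emod_lt_of_pos x hn
    have := Int.emod_nonneg x hn.ne'
    omega⟩

theorem cyclicDist_le_iff {n m : ℕ} {i j : Fin n} :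
    cyclicDist n i j ≤ m ↔ ∃ k : ℤ, k ≡ (i : ℤ) - (j : ℤ) [ZMOD n] ∧ |k| ≤ m := by
  constructor
  · intro h
    obtain ⟨k, hk, hk'⟩ := Nat.sInf_mem (s := {a : ℕ | ∃ k : ℤ,
      k ≡ (i : ℤ) - (j : ℤ) [ZMOD n] ∧ k.natAbs = a}) ⟨_, _, Int.ModEq.refl _, rfl⟩
    change k.natAbs = cyclicDist n i j at hk'
    exact ⟨k, hk, by rw [Int.abs_eq_natAbs]; omega⟩
  · rintro ⟨k, hk, hkm⟩
    rw [Int.abs_eq_natAbs] at hkm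
    exact (Nat.sInf_le (show k.natAbs ∈ {a : ℕ | ∃ k : ℤ,
      k ≡ (i : ℤ) - (j : ℤ) [ZMOD n] ∧ k.natAbs = a} from ⟨k, hk, rfl⟩)).trans (by omega)

section

variable {n : ℕ} [NeZero n]

theorem coe_intToFin (x : ℤ) : ((intToFin n x : ℕ) : ℤ) = x % n :=
  Int.toNat_of_nonneg (Int.emod_nonneg x (by exact_mod_cast NeZero.ne n))

theorem intToFin_coe (i : Fin n) : intToFin n ((i : ℕ) : ℤ) = i := by
  apply Fin.ext
  have : ((intToFin n ((i : ℕ) : ℤ) : ℕ) : ℤ) = (i : ℕ) := by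
    rw [coe_intToFin]
    exact Int.emod_eq_of_lt (by positivity) (by exact_mod_cast i.2)
  exact_mod_cast this

theorem intToFin_eq_iff {x y : ℤ} : intToFin n x = intToFin n y ↔ ∃ k : ℤ, x = y + k * n := by
  rw [Fin.ext_iff, ← Int.natCast_inj, coe_intToFin, coe_intToFin]
  constructor
  · intro h
    obtain ⟨k, hk⟩ := (Int.modEq_iff_dvd (n := n)).1 (show y ≡ x [ZMOD n] from h.symm)
    exact ⟨k, by linarith⟩
  · rintro ⟨k, rfl⟩
    simp

theorem cyclicDist_intToFin_le_iff {m : ℕ} {x y : ℤ} :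
    cyclicDist n (intToFin n x) (intToFin n y) ≤ m ↔ ∃ k : ℤ, |x + k * n - y| ≤ m := by
  rw [cyclicDist_le_iff]
  have h : ∀ k : ℤ, k ≡ (intToFin n x : ℤ) - (intToFin n y : ℤ) [ZMOD n] ↔
      ∃ l : ℤ, x + l * n - y = k := fun k => by
    rw [coe_intToFin, coe_intToFin]
    have : x % n - y % n ≡ x - y [ZMOD n] := (Int.mod_modEq _ _).sub (Int.mod_modEq _ _)
    constructor
    · intro hk
      obtain ⟨l, hl⟩ := (hk.trans this).symm.dvd
      exact ⟨l, by linarith⟩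
    · rintro ⟨l, rfl⟩
      refine Int.ModEq.trans ?_ this.symm
      exact (Int.modEq_iff_dvd.2 ⟨l, by ring⟩ : x - y ≡ x + l * n - y [ZMOD n]).symm
  constructor
  · rintro ⟨k, hk, hkm⟩
    obtain ⟨l, rfl⟩ := (h k).1 hk
    exact ⟨l, hkm⟩
  · rintro ⟨l, hl⟩
    exact ⟨_, (h _).2 ⟨l, rfl⟩, hl⟩

end

open CechClosure Topology

theorem isContinuous_rootsOfUnityClosure_iff {T : Type*} [TopologicalSpace T] {n m : ℕ}
    {f : T → Fin n} : IsContinuous (ofTopology T) (rootsOfUnityClosure n m) f ↔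
      ∀ x, ∀ᶠ y in 𝓝 x, cyclicDist n (f y) (f x) ≤ m :=
  isContinuous_ofRel_iff (r := fun i j => cyclicDist n i j ≤ m)
    (hr := fun i => by simp [cyclicDist_self])

theorem isContinuous_intClosure_iff {T : Type*} [TopologicalSpace T] {m : ℕ}
    {f : T → ℤ} : IsContinuous (ofTopology T) (intClosure m) f ↔
      ∀ x, ∀ᶠ y in 𝓝 x, |f y - f x| ≤ m :=
  isContinuous_ofRel_iff

theorem isContinuous_intToFin (n m : ℕ) [NeZero n] :
    IsContinuous (intClosure m) (rootsOfUnityClosure n m) (intToFin n) := by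
  rintro A _ ⟨y, hy, rfl⟩
  simp only [intClosure, ofRel, Set.mem_iUnion] at hy
  obtain ⟨x, hx, hxy⟩ := hy
  exact Set.mem_biUnion ⟨x, hx, rfl⟩ (cyclicDist_intToFin_le_iff.2 ⟨0, by simpa using hxy⟩)

theorem eq_zero_of_abs_mul_lt {k : ℤ} {n : ℕ} (h : |k * n| < n) : k = 0 := by
  have h1 := Int.eq_zero_of_abs_lt_dvd (m := n) (dvd_mul_left _ k) h
  have : n ≠ 0 := by rintro rfl; simp at h
  simpa [this] using h1

/-- Two lifts to `ℤ` of the same map to `ℤ_n` that are continuous at a point differ by a constant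
near it: the difference is a multiple of `n` that changes by at most `2 * m < n`. -/
theorem eventually_sub_eq_of_lifts {T : Type*} [TopologicalSpace T] {m n : ℕ} [NeZero n]
    (hnm : 2 * m < n) {f g : T → ℤ} {x : T} (hf : ∀ᶠ y in 𝓝 x, |f y - f x| ≤ m)
    (hg : ∀ᶠ y in 𝓝 x, |g y - g x| ≤ m)
    (hfg : ∀ᶠ y in 𝓝 x, intToFin n (f y) = intToFin n (g y)) :
    ∀ᶠ y in 𝓝 x, f y - g y = f x - g x := by
  filter_upwards [hf, hg, hfg] with y h1 h2 h3
  obtain ⟨k, hk⟩ := intToFin_eq_iff.1 h3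
  obtain ⟨l, hl⟩ := intToFin_eq_iff.1 hfg.self_of_nhds
  have h4 : |(k - l) * n| < n := by
    rw [abs_le] at h1 h2
    rw [abs_lt]
    constructor <;> nlinarith
  have h5 : k = l := sub_eq_zero.1 (eq_zero_of_abs_mul_lt h4)
  rw [hk, hl, h5]
  ring

/-- Lifts of a continuous map exist over a contractible space. The local lifts that stay within `m`
of a lift of the value at a point are continuous because `3 * m < n`; their differences form a
locally constant cocycle. -/
theorem exists_lift_intClosure {T : Type} [TopologicalSpace T] [ContractibleSpace T] {m n : ℕ}
    [NeZero n] (hnm : 3 * m < n) {f : T → Fin n}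
    (hf : IsContinuous (ofTopology T) (rootsOfUnityClosure n m) f) :
    ∃ g : T → ℤ, IsContinuous (ofTopology T) (intClosure m) g ∧ intToFin n ∘ g = f := by
  rw [isContinuous_rootsOfUnityClosure_iff] at hf
  have hmem : ∀ x, ∃ U : Set T, (∀ y ∈ U, cyclicDist n (f y) (f x) ≤ m) ∧ IsOpen U ∧ x ∈ U :=
    fun x => by simpa using eventually_nhds_iff.1 (hf x)
  choose U hUf hU hxU using hmem
  have hloc : ∀ i y, ∃ l : ℤ, intToFin n l = f y ∧ (y ∈ U i → |l - (f i : ℕ)| ≤ m) := fun i y => by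
    by_cases hy : y ∈ U i
    · have := hUf i y hy
      rw [← intToFin_coe (f y), ← intToFin_coe (f i), cyclicDist_intToFin_le_iff] at this
      obtain ⟨k, hk⟩ := this
      exact ⟨_, (intToFin_eq_iff.2 ⟨k, rfl⟩).trans (intToFin_coe _), fun _ => hk⟩
    · exact ⟨(f y : ℕ), intToFin_coe _, fun h => absurd h hy⟩
  choose l hl hlU using hloc
  have hlc : ∀ i, ∀ x ∈ U i, ∀ᶠ y in 𝓝 x, |l i y - l i x| ≤ m := fun i x hx => by
    filter_upwards [(hU i).mem_nhds hx, hf x] with y hy hxy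
    rw [← hl i y, ← hl i x, cyclicDist_intToFin_le_iff] at hxy
    obtain ⟨k, hk⟩ := hxy
    have h1 := hlU i x hx
    have h2 := hlU i y hy
    have h4 : |k * n| < n := by
      rw [abs_le] at h1 h2 hk
      rw [abs_lt]
      constructor <;> linarith
    simpa [eq_zero_of_abs_mul_lt h4] using hk
  -- `n * a i j` is the difference of two local lifts, `b` corrects them to agree on overlaps
  have hex : ∀ i j x, ∃ a : ℤ, l i x = l j x + a * n := fun i j x =>
    intToFin_eq_iff.1 ((hl i x).trans (hl j x).symm)
  choose a ha using hex
  have hn : (n : ℤ) ≠ 0 := by exact_mod_cast NeZero.ne n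
  obtain ⟨b, hb, hbloc⟩ := exists_coboundary_of_contractible U hU id hxU a
    (fun i j k x _ => mul_right_cancel₀ hn (by linarith [ha i j x, ha j k x, ha i k x]))
    (fun i j x hx => by
      filter_upwards [eventually_sub_eq_of_lifts (by omega) (hlc i x hx.1) (hlc j x hx.2)
        (.of_forall fun y => (hl i y).trans (hl j y).symm)] with y hy
      exact mul_right_cancel₀ hn (by linarith [ha i j x, ha i j y]))
  have hglue : ∀ i, ∀ x ∈ U i, l x x + b x x * n = l i x + b i x * n := fun i x hx => by
    rw [← hb x i x ⟨hxU x, hx⟩, ha x i x]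
    ring
  refine ⟨fun x => l x x + b x x * n, isContinuous_intClosure_iff.2 fun x => ?_, ?_⟩
  · filter_upwards [(hU x).mem_nhds (hxU x), hlc x x (hxU x), hbloc x x (hxU x)] with y hy h1 h2
    rw [hglue x y hy, h2]
    simpa using h1
  · funext x
    rw [← hl x x]
    exact intToFin_eq_iff.2 ⟨b x x, rfl⟩

/-- Two lifts over a connected space differ by a translation. -/
theorem eq_add_of_lifts {T : Type*} [TopologicalSpace T] [ConnectedSpace T] {m n : ℕ}
    [NeZero n] (hnm : 2 * m < n) {f g : T → ℤ}
    (hf : IsContinuous (ofTopology T) (intClosure m) f)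
    (hg : IsContinuous (ofTopology T) (intClosure m) g)
    (hfg : intToFin n ∘ f = intToFin n ∘ g) : ∃ k : ℤ, ∀ x, f x = g x + k * n := by
  rw [isContinuous_intClosure_iff] at hf hg
  have hlc : IsLocallyConstant (fun x => f x - g x) :=
    (IsLocallyConstant.iff_eventually_eq _).2 fun x => eventually_sub_eq_of_lifts hnm (hf x) (hg x)
      (.of_forall fun y => congrFun hfg y)
  obtain ⟨x₀⟩ := (inferInstance : Nonempty T)
  obtain ⟨k, hk⟩ := intToFin_eq_iff.1 (congrFun hfg x₀)
  refine ⟨k, fun x => ?_⟩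
  have := hlc.apply_eq_of_preconnectedSpace x x₀
  linarith

/-! ### The standard simplex as a cone -/

/-- The map `|Δⁿ| × [0, 1] → |Δⁿ⁺¹|` that presents `|Δⁿ⁺¹|` as the cone with apex `e₀` over the
face opposite to `e₀`: it collapses `|Δⁿ| × {1}` to the apex. -/
noncomputable def coneMap (n : ℕ) (p : stdSimplex ℝ (Fin (n + 1)) × unitInterval) :
    stdSimplex ℝ (Fin (n + 2)) :=
  ⟨Fin.cons (p.2 : ℝ) fun i => (1 - (p.2 : ℝ)) * p.1 i, by
    refine ⟨fun i => ?_, ?_⟩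
    · refine Fin.cases p.2.2.1 (fun i => ?_) i
      exact mul_nonneg (sub_nonneg.2 p.2.2.2) (stdSimplex.zero_le p.1 i)
    · rw [Fin.sum_univ_succ]
      simp [← Finset.mul_sum]⟩

theorem coneMap_zero {n : ℕ} (p : stdSimplex ℝ (Fin (n + 1)) × unitInterval) :
    coneMap n p 0 = p.2 := rfl

theorem coneMap_succ {n : ℕ} (p : stdSimplex ℝ (Fin (n + 1)) × unitInterval) (i : Fin (n + 1)) :
    coneMap n p i.succ = (1 - (p.2 : ℝ)) * p.1 i := rfl

theorem stdSimplex_ext_cons {n : ℕ} {x y : stdSimplex ℝ (Fin (n + 2))} (h0 : x 0 = y 0)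
    (hs : ∀ i : Fin (n + 1), x i.succ = y i.succ) : x = y :=
  stdSimplex.ext (funext (Fin.cases h0 hs))

theorem continuous_coneMap (n : ℕ) : Continuous (coneMap n) := by
  refine Continuous.subtype_mk (continuous_pi fun i => ?_) _
  refine Fin.cases ?_ (fun i => ?_) i
  · exact continuous_subtype_val.comp continuous_snd
  · have : Continuous fun p : stdSimplex ℝ (Fin (n + 1)) × unitInterval => p.1 i :=
      (continuous_apply i).comp (continuous_subtype_val.comp continuous_fst)
    simp only [Fin.cons_succ]
    fun_prop

theorem coneMap_surjective (n : ℕ) : Function.Surjective (coneMap n) := by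
  intro x
  have hsum : ∑ i : Fin (n + 1), x i.succ = 1 - x 0 := by
    have := stdSimplex.sum_eq_one x
    rw [Fin.sum_univ_succ] at this
    linarith
  by_cases hx : x 0 = 1
  · refine ⟨(stdSimplex.vertex 0, 1), stdSimplex_ext_cons (by simp [coneMap_zero, hx]) fun i => ?_⟩
    rw [hx, sub_self, Finset.sum_eq_zero_iff_of_nonneg fun i _ => stdSimplex.zero_le x _] at hsum
    simp [coneMap_succ, hsum i]
  · have hpos : 0 < 1 - x 0 := lt_of_le_of_ne (sub_nonneg.2 (stdSimplex.le_one x 0)) (by grind)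
    refine ⟨(⟨fun i => x i.succ / (1 - x 0), fun i => ?_, ?_⟩,
      ⟨x 0, stdSimplex.zero_le x 0, stdSimplex.le_one x 0⟩),
      stdSimplex_ext_cons rfl fun i => ?_⟩
    · exact div_nonneg (stdSimplex.zero_le x _) hpos.le
    · rw [← Finset.sum_div, hsum, div_self hpos.ne']
    · exact mul_div_cancel₀ _ hpos.ne'

theorem eq_of_coneMap_eq {n : ℕ} {p q : stdSimplex ℝ (Fin (n + 1)) × unitInterval}
    (h : coneMap n p = coneMap n q) : p = q ∨ p.2 = 1 ∧ q.2 = 1 := by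
  obtain ⟨y, s⟩ := p
  obtain ⟨z, t⟩ := q
  obtain rfl : s = t := Subtype.ext (DFunLike.congr_fun h 0)
  by_cases hs : s = 1
  · exact .inr ⟨hs, hs⟩
  · left
    congr 1
    refine stdSimplex.ext (funext fun i => ?_)
    have h1 := DFunLike.congr_fun h i.succ
    rw [coneMap_succ, coneMap_succ] at h1
    exact mul_left_cancel₀ (sub_ne_zero.2 fun h => hs (Subtype.ext h.symm)) h1

/-- Precomposition with a closed surjection detects continuity into a closure space.
For an arbitrary topological quotient map this fails. -/
theorem CechClosure.IsContinuous.of_comp_closedMap {T S X : Type*} [TopologicalSpace T]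
    [TopologicalSpace S] {c : CechClosure X} {q : T → S} (hq : IsClosedMap q)
    (hsurj : Function.Surjective q) {f : S → X} (hf : IsContinuous (ofTopology T) c (f ∘ q)) :
    IsContinuous (ofTopology S) c f := by
  intro A
  have h1 : closure A ⊆ q '' closure (q ⁻¹' A) := by
    refine closure_minimal ?_ (hq _ isClosed_closure)
    exact (Set.image_preimage_eq A hsurj).ge.trans (Set.image_mono subset_closure)
  calc f '' closure A ⊆ f '' (q '' closure (q ⁻¹' A)) := Set.image_mono h1
    _ = (f ∘ q) '' closure (q ⁻¹' A) := by rw [Set.image_comp]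
    _ ⊆ c.cl ((f ∘ q) '' (q ⁻¹' A)) := hf _
    _ = c.cl (f '' A) := by rw [Set.image_comp, Set.image_preimage_eq A hsurj]

/-- The map of cones induced by a map of bases, on vertices. -/
def finCone {n k : ℕ} (f : Fin (n + 1) → Fin (k + 1)) : Fin (n + 2) → Fin (k + 2) :=
  Fin.cons 0 fun i => (f i).succ

theorem map_coneMap {n k : ℕ} (f : Fin (n + 1) → Fin (k + 1))
    (p : stdSimplex ℝ (Fin (n + 1)) × unitInterval) :
    stdSimplex.map (finCone f) (coneMap n p) = coneMap k (stdSimplex.map f p.1, p.2) := by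
  refine stdSimplex_ext_cons ?_ fun i => ?_
  · rw [coneMap_zero, stdSimplex.map_coe, FunOnFinite.linearMap_apply_apply, Finset.sum_filter,
      Fin.sum_univ_succ]
    simp [finCone, coneMap_zero]
  · rw [coneMap_succ, stdSimplex.map_coe, FunOnFinite.linearMap_apply_apply, Finset.sum_filter,
      Fin.sum_univ_succ, stdSimplex.map_coe, FunOnFinite.linearMap_apply_apply, Finset.sum_filter,
      Finset.mul_sum]
    simp [finCone, coneMap_succ, (Fin.succ_ne_zero _).symm]

theorem map_succ_eq_coneMap {n : ℕ} (y : stdSimplex ℝ (Fin (n + 1))) :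
    stdSimplex.map Fin.succ y = coneMap n (y, 0) := by
  refine stdSimplex_ext_cons ?_ fun i => ?_
  · rw [coneMap_zero, stdSimplex.map_coe, FunOnFinite.linearMap_apply_apply, Finset.sum_filter]
    simp
  · rw [coneMap_succ, stdSimplex.map_coe, FunOnFinite.linearMap_apply_apply, Finset.sum_filter]
    simp

theorem map_zero_eq_coneMap {n : ℕ} (y : stdSimplex ℝ (Fin (n + 1))) {k : ℕ}
    (z : stdSimplex ℝ (Fin (k + 1))) :
    stdSimplex.map (fun _ => (0 : Fin (n + 2))) z = coneMap n (y, 1) := by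
  refine stdSimplex_ext_cons ?_ fun i => ?_
  · rw [coneMap_zero, stdSimplex.map_coe, FunOnFinite.linearMap_apply_apply, Finset.sum_filter]
    simp
  · rw [coneMap_succ, stdSimplex.map_coe, FunOnFinite.linearMap_apply_apply, Finset.sum_filter]
    simp [(Fin.succ_ne_zero _).symm]

/-! ### Deformations onto discrete sets -/

namespace CechClosure

/-- A deformation of a closure space into a discrete set `A` of its points: a homotopy `H` from the
identity to a retraction `inc ∘ ret` onto `A` that is constant on each singular simplex. Continuity
of `H` is only required along singular simplices, which avoids products of closure spaces. -/
structure DiscreteDeformation {X : Type} (c : CechClosure X) (A : Type) where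
  /-- the retraction onto the discrete set -/
  ret : X → A
  /-- the inclusion of the discrete set -/
  inc : A → X
  /-- the homotopy -/
  H : X → unitInterval → X
  ret_inc : ∀ a, ret (inc a) = a
  H_zero : ∀ x, H x 0 = x
  H_one : ∀ x, H x 1 = inc (ret x)
  ret_const : ∀ (n : ℕ) (σ : SingularSimplex c n) x y, ret (σ.1 x) = ret (σ.1 y)
  continuous_H : ∀ (n : ℕ) (σ : SingularSimplex c n),
    IsContinuous (ofTopology (stdSimplex ℝ (Fin (n + 1)) × unitInterval)) c
      fun p => H (σ.1 p.1) p.2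

namespace DiscreteDeformation

variable {X A : Type} {c : CechClosure X} (D : DiscreteDeformation c A)

theorem H_eq_of_coneMap_eq {n : ℕ} (σ : SingularSimplex c n)
    {p q : stdSimplex ℝ (Fin (n + 1)) × unitInterval} (h : coneMap n p = coneMap n q) :
    D.H (σ.1 p.1) p.2 = D.H (σ.1 q.1) q.2 := by
  rcases eq_of_coneMap_eq h with rfl | ⟨hp, hq⟩
  · rfl
  · rw [hp, hq, D.H_one, D.H_one, D.ret_const n σ p.1 q.1]

/-- The cone on a singular simplex, traced out by the homotopy. -/
noncomputable def cone {n : ℕ} (σ : SingularSimplex c n) : SingularSimplex c (n + 1) :=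
  ⟨fun x => D.H (σ.1 (Function.surjInv (coneMap_surjective n) x).1)
      (Function.surjInv (coneMap_surjective n) x).2, by
    refine IsContinuous.of_comp_closedMap (continuous_coneMap n).isClosedMap
      (coneMap_surjective n) ?_
    convert D.continuous_H n σ using 1
    funext p
    exact D.H_eq_of_coneMap_eq σ (Function.surjInv_eq (coneMap_surjective n) _)⟩

theorem cone_coneMap {n : ℕ} (σ : SingularSimplex c n)
    (p : stdSimplex ℝ (Fin (n + 1)) × unitInterval) :
    (D.cone σ).1 (coneMap n p) = D.H (σ.1 p.1) p.2 :=
  D.H_eq_of_coneMap_eq σ (Function.surjInv_eq (coneMap_surjective n) _)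

theorem ext_coneMap {n : ℕ} {f g : stdSimplex ℝ (Fin (n + 2)) → X}
    (h : ∀ p, f (coneMap n p) = g (coneMap n p)) : f = g := by
  funext x
  obtain ⟨p, rfl⟩ := coneMap_surjective n x
  exact h p

/-- Coning is natural for maps of the base simplex. -/
theorem cone_comp_map {n k : ℕ} (σ : SingularSimplex c k) (τ : SingularSimplex c n)
    (f : Fin (n + 1) → Fin (k + 1)) (hτ : τ.1 = σ.1 ∘ stdSimplex.map f) :
    (D.cone σ).1 ∘ stdSimplex.map (finCone f) = (D.cone τ).1 := by
  refine ext_coneMap fun p => ?_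
  rw [Function.comp_apply, map_coneMap, cone_coneMap, cone_coneMap, hτ]
  rfl

open Opposite Simplicial

/-- The constant singular simplex at a point. -/
def constSimplex (c : CechClosure X) (n : ℕ) (x : X) : SingularSimplex c n :=
  ⟨fun _ => x, by
    rintro S _ ⟨y, hy, rfl⟩
    have hS : S.Nonempty := closure_nonempty_iff.1 ⟨y, hy⟩
    rw [hS.image_const]
    exact c.subset_cl _ rfl⟩

/-- The singular simplicial set of `c`, augmented over the discrete set. -/
noncomputable def augmented : SimplicialObject.Augmented Type where
  left := singularSet c
  right := A
  hom :=
    { app n := ↾fun σ : SingularSimplex c n.unop.len => D.ret (σ.1 (stdSimplex.vertex 0))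
      naturality n k f := by
        refine ConcreteCategory.hom_ext _ _ fun σ => ?_
        exact D.ret_const _ σ _ _ }

/-- The cones form an extra degeneracy of the singular simplicial set. -/
noncomputable def extraDegeneracy : D.augmented.ExtraDegeneracy where
  s' := ↾fun a : A => constSimplex c 0 (D.inc a)
  s n := ↾fun σ : SingularSimplex c n => D.cone σ
  s'_comp_ε := by
    refine ConcreteCategory.hom_ext _ _ fun a => ?_
    exact D.ret_inc a
  s₀_comp_δ₁ := by
    refine ConcreteCategory.hom_ext _ _
      fun (σ : SingularSimplex c 0) => Subtype.ext (funext fun z => ?_)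
    change (D.cone σ).1 (stdSimplex.map (SimplexCategory.δ (n := 0) 1).toOrderHom z) =
      D.inc (D.ret (σ.1 (stdSimplex.vertex 0)))
    have h : ⇑(SimplexCategory.δ (n := 0) 1).toOrderHom = fun _ => (0 : Fin 2) := by
      funext i
      fin_cases i
      rfl
    rw [h, map_zero_eq_coneMap (stdSimplex.vertex 0), cone_coneMap, D.H_one]
  s_comp_δ₀ n := by
    refine ConcreteCategory.hom_ext _ _
      fun (σ : SingularSimplex c n) => Subtype.ext (funext fun z => ?_)
    change (D.cone σ).1 (stdSimplex.map Fin.succ z) = σ.1 z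
    rw [map_succ_eq_coneMap, cone_coneMap, D.H_zero]
  s_comp_δ n i := by
    refine ConcreteCategory.hom_ext _ _ fun (σ : SingularSimplex c (n + 1)) => Subtype.ext ?_
    have h : ⇑(SimplexCategory.δ i.succ).toOrderHom = finCone i.succAbove := by
      funext j
      refine Fin.cases ?_ (fun j => ?_) j
      · exact Fin.succ_succAbove_zero i
      · exact Fin.succ_succAbove_succ i j
    change (D.cone σ).1 ∘ stdSimplex.map (SimplexCategory.δ i.succ).toOrderHom = _
    rw [h]
    exact D.cone_comp_map σ _ _ rfl
  s_comp_σ n i := by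
    refine ConcreteCategory.hom_ext _ _ fun (σ : SingularSimplex c n) => Subtype.ext ?_
    have h : ⇑(SimplexCategory.σ i.succ).toOrderHom = finCone i.predAbove := by
      funext j
      refine Fin.cases ?_ (fun j => ?_) j
      · exact Fin.predAbove_right_zero (i := i.succ)
      · exact Fin.succ_predAbove_succ i j
    change (D.cone σ).1 ∘ stdSimplex.map (SimplexCategory.σ i.succ).toOrderHom = _
    rw [h]
    exact D.cone_comp_map σ _ _ rfl

theorem subsingleton_singularHomology (D : DiscreteDeformation c A) {k : ℕ} (hk : k ≠ 0) :
    Subsingleton (c.singularHomology k) := by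
  have e := ((D.extraDegeneracy.map (ModuleCat.free ℤ)).homotopyEquiv).toHomologyIso k
  refine ModuleCat.subsingleton_of_isZero (Limits.IsZero.of_iso ?_ e)
  exact HomologicalComplex.isZero_single_obj_homology _ _ _ _ hk

end DiscreteDeformation

end CechClosure

/-! ### Chains modulo a free action of an infinite cyclic group -/

section Finsupp

variable {S Q : Type*} {T : S → S} {q : S → Q}

/-- If all orbits of `T` are infinite, a finitely supported `T`-invariant chain vanishes. -/
theorem eq_zero_of_mapDomain_sub_self_eq_zero (hT : Function.Injective T)
    (hfree : ∀ a (k : ℕ), T^[k] a = a → k = 0) {x : S →₀ ℤ}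
    (hx : x.mapDomain T - x = 0) : x = 0 := by
  by_contra hne
  obtain ⟨a, ha⟩ := Finsupp.ne_iff.1 hne
  have hiter : ∀ k : ℕ, x (T^[k] a) = x a := fun k => by
    induction k with
    | zero => rfl
    | succ k ih =>
      rw [Function.iterate_succ_apply', ← ih, ← Finsupp.mapDomain_apply hT x (T^[k] a),
        sub_eq_zero.1 hx]
  have hinj : Function.Injective fun k : ℕ => T^[k] a := by
    have key : ∀ k l : ℕ, k ≤ l → T^[k] a = T^[l] a → k = l := fun k l hkl h => by
      obtain ⟨d, rfl⟩ := Nat.exists_eq_add_of_le hkl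
      rw [Function.iterate_add_apply] at h
      have := hfree a d (hT.iterate k h).symm
      omega
    intro k l h
    rcases le_total k l with hkl | hkl
    · exact key k l hkl h
    · exact (key l k hkl h.symm).symm
  refine Set.infinite_range_of_injective hinj (x.hasFiniteSupport.subset ?_)
  rintro _ ⟨k, rfl⟩
  simpa [hiter] using ha

/-- If the fibres of `q` are the orbits of `T`, the kernel of `q` on chains is the image of
`T - 1`. -/
theorem exists_mapDomain_sub_self (hqsurj : Function.Surjective q)
    (hq : ∀ a b, q a = q b → ∃ k : ℕ, T^[k] a = b ∨ T^[k] b = a) {x : S →₀ ℤ}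
    (hx : x.mapDomain q = 0) : ∃ y : S →₀ ℤ, y.mapDomain T - y = x := by
  let f : (S →₀ ℤ) →ₗ[ℤ] (S →₀ ℤ) := Finsupp.lmapDomain ℤ ℤ T - LinearMap.id
  have hf : ∀ y, f y = y.mapDomain T - y := fun y => rfl
  have hiter : ∀ (k : ℕ) a, Finsupp.single (T^[k] a) (1 : ℤ) - Finsupp.single a 1 ∈ f.range :=
    fun k a => by
      induction k with
      | zero => simp
      | succ k ih =>
        have : f (Finsupp.single (T^[k] a) 1) ∈ f.range := ⟨_, rfl⟩
        rw [hf, Finsupp.mapDomain_single, ← Function.iterate_succ_apply' T k a] at this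
        simpa using add_mem this ih
  have hrel : ∀ a b, q a = q b →
      Finsupp.single b (1 : ℤ) - Finsupp.single a 1 ∈ f.range := fun a b hab => by
    obtain ⟨k, rfl | rfl⟩ := hq a b hab
    · exact hiter k a
    · simpa using neg_mem (hiter k b)
  let s : Q → S := Function.surjInv hqsurj
  -- modulo the range of `f`, a chain is determined by its image under `q`
  have hmod : ∀ z : S →₀ ℤ, z - (z.mapDomain q).mapDomain s ∈ f.range := fun z => by
    induction z using Finsupp.induction_linear with
    | zero => simp
    | add z w hz hw =>
      rw [Finsupp.mapDomain_add, Finsupp.mapDomain_add, add_sub_add_comm]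
      exact add_mem hz hw
    | single a c =>
      rw [Finsupp.mapDomain_single, Finsupp.mapDomain_single]
      have := f.range.smul_mem c (hrel (s (q a)) a (Function.surjInv_eq hqsurj (q a)))
      simpa [smul_sub] using this
  have := hmod x
  rw [hx, Finsupp.mapDomain_zero, sub_zero] at this
  exact this

end Finsupp

namespace CechClosure

variable {X Y Z : Type} {c : CechClosure X} {d : CechClosure Y} {e : CechClosure Z}

/-- The map of singular simplices induced by a continuous map. -/
def SingularSimplex.map {f : X → Y} (hf : IsContinuous c d f) (n : ℕ) (σ : SingularSimplex c n) :
    SingularSimplex d n :=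
  ⟨f ∘ σ.1, hf.comp σ.2⟩

/-- The map of singular simplicial sets induced by a continuous map. -/
noncomputable def singularSetMap {f : X → Y} (hf : IsContinuous c d f) :
    singularSet c ⟶ singularSet d where
  app n := ↾fun σ => SingularSimplex.map hf n.unop.len σ
  naturality _ _ _ := rfl

/-- The map of singular chain complexes induced by a continuous map. -/
noncomputable def singularChainMap {f : X → Y} (hf : IsContinuous c d f) :
    c.singularChainComplex ⟶ d.singularChainComplex :=
  (AlgebraicTopology.alternatingFaceMapComplex (ModuleCat.{0} ℤ)).map
    (((SimplicialObject.whiskering _ _).obj (ModuleCat.free ℤ)).map (singularSetMap hf))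

theorem singularChainMap_comp {f : X → Y} {g : Y → Z} (hf : IsContinuous c d f)
    (hg : IsContinuous d e g) :
    singularChainMap hf ≫ singularChainMap hg = singularChainMap (hg.comp hf) := by
  exact ((((SimplicialObject.whiskering _ _).obj (ModuleCat.free ℤ)) ⋙
    AlgebraicTopology.alternatingFaceMapComplex (ModuleCat.{0} ℤ)).map_comp
      (singularSetMap hf) (singularSetMap hg)).symm

/-- The short complex `C(X) → C(X) → C(Y)` whose first map is `t - 1` for a map `t` that is
compatible with the projection to `Y`. -/
noncomputable def deckShortComplex {t : X → X} {p : X → Y} (ht : IsContinuous c c t)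
    (hp : IsContinuous c d p) (htp : p ∘ t = p) :
    ShortComplex (ChainComplex (ModuleCat.{0} ℤ) ℕ) :=
  ShortComplex.mk (singularChainMap ht - 𝟙 _) (singularChainMap hp) (by
    rw [Preadditive.sub_comp, singularChainMap_comp, Category.id_comp, sub_eq_zero]
    congr 1)

/-- The sequence is short exact if simplices of `Y` lift to `X`, uniquely up to powers of `t`, and
`t` acts freely. -/
theorem deckShortComplex_shortExact {t : X → X} {p : X → Y} (ht : IsContinuous c c t)
    (hp : IsContinuous c d p) (htp : p ∘ t = p) (htinj : Function.Injective t)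
    (hfree : ∀ x (k : ℕ), t^[k] x = x → k = 0)
    (hlift : ∀ (n : ℕ) (σ : SingularSimplex d n), ∃ τ : SingularSimplex c n, p ∘ τ.1 = σ.1)
    (huniq : ∀ (n : ℕ) (σ τ : SingularSimplex c n), p ∘ σ.1 = p ∘ τ.1 →
      ∃ k : ℕ, t^[k] ∘ σ.1 = τ.1 ∨ t^[k] ∘ τ.1 = σ.1) :
    (deckShortComplex ht hp htp).ShortExact := by
  refine HomologicalComplex.shortExact_of_degreewise_shortExact _ fun n => ?_
  have hiter : ∀ (k : ℕ) (σ : SingularSimplex c n),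
      ((SingularSimplex.map ht n)^[k] σ).1 = t^[k] ∘ σ.1 := fun k σ => by
    induction k with
    | zero => rfl
    | succ k ih =>
      rw [Function.iterate_succ_apply', Function.iterate_succ', Function.comp_assoc, ← ih]
      rfl
  have hTinj : Function.Injective (SingularSimplex.map ht n) := fun σ τ h =>
    Subtype.ext (funext fun x => htinj (congrFun (congrArg Subtype.val h) x))
  have hTfree : ∀ (σ : SingularSimplex c n) (k : ℕ),
      (SingularSimplex.map ht n)^[k] σ = σ → k = 0 := fun σ k h => by
    have := congrFun ((hiter k σ).symm.trans (congrArg Subtype.val h)) (stdSimplex.vertex 0)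
    exact hfree _ k this
  have hqsurj : Function.Surjective (SingularSimplex.map hp n) := fun σ => by
    obtain ⟨τ, hτ⟩ := hlift n σ
    exact ⟨τ, Subtype.ext hτ⟩
  have hq : ∀ σ τ : SingularSimplex c n, SingularSimplex.map hp n σ = SingularSimplex.map hp n τ →
      ∃ k : ℕ, (SingularSimplex.map ht n)^[k] σ = τ ∨ (SingularSimplex.map ht n)^[k] τ = σ :=
    fun σ τ h => by
      obtain ⟨k, hk⟩ := huniq n σ τ (congrArg Subtype.val h)
      exact ⟨k, hk.imp (fun h => Subtype.ext ((hiter k σ).trans h))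
        fun h => Subtype.ext ((hiter k τ).trans h)⟩
  refine { exact := ?_, mono_f := ?_, epi_g := ?_ }
  · rw [ShortComplex.moduleCat_exact_iff]
    intro (x : SingularSimplex c n →₀ ℤ) hx
    exact exists_mapDomain_sub_self hqsurj hq hx
  · rw [ModuleCat.mono_iff_injective, injective_iff_map_eq_zero]
    intro (x : SingularSimplex c n →₀ ℤ) hx
    exact eq_zero_of_mapDomain_sub_self_eq_zero hTinj hTfree hx
  · rw [ModuleCat.epi_iff_surjective]
    exact Finsupp.mapDomain_surjective hqsurj

end CechClosure

/-! ### The covering of `ℤ_n` by `ℤ` -/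

theorem isContinuous_add_intClosure (m : ℕ) (a : ℤ) :
    IsContinuous (intClosure m) (intClosure m) (· + a) := by
  rintro A _ ⟨y, hy, rfl⟩
  simp only [intClosure, ofRel, Set.mem_iUnion] at hy
  obtain ⟨x, hx, hxy⟩ := hy
  exact Set.mem_biUnion ⟨x, hx, rfl⟩ (by simpa using hxy)

theorem iterate_add_intCast (a x : ℤ) (k : ℕ) : (· + a)^[k] x = x + k * a := by
  simp

/-- The covering `(ℤ, c_m) → (ℤ_n, c_m)` makes the singular chains of the base the coinvariants of
the deck group, which is infinite cyclic and acts freely. -/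
theorem shortExact_intToFin {n m : ℕ} [NeZero n] (hnm : 3 * m < n) :
    (deckShortComplex (isContinuous_add_intClosure m n) (isContinuous_intToFin n m)
      (funext fun x => intToFin_eq_iff.2 ⟨1, by simp⟩)).ShortExact := by
  have hcontr : ∀ k, ContractibleSpace (stdSimplex ℝ (Fin (k + 1))) := fun k =>
    (convex_stdSimplex ℝ _).contractibleSpace ⟨_, single_mem_stdSimplex ℝ 0⟩
  refine deckShortComplex_shortExact _ _ _ (add_left_injective _) (fun x k h => ?_)
    (fun k σ => ?_) (fun k σ τ h => ?_)
  · rw [iterate_add_intCast] at h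
    simpa [NeZero.ne n] using h
  · obtain ⟨g, hg, hgσ⟩ := exists_lift_intClosure hnm σ.2
    exact ⟨⟨g, hg⟩, hgσ⟩
  · obtain ⟨l, hl⟩ := eq_add_of_lifts (by omega) σ.2 τ.2 h
    refine ⟨l.natAbs, ?_⟩
    rcases Int.natAbs_eq l with h | h
    · right
      funext x
      rw [Function.comp_apply, iterate_add_intCast, hl, ← h]
    · left
      funext x
      rw [Function.comp_apply, iterate_add_intCast, hl, h]
      simp

/-! ### Contracting `ℤ` -/

/-- The truncation of an integer to the interval `[-N, N]`, where `N + 1 = ⌊1 / s⌋` for `s` in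
`(0, 1]`; for `s = 0` nothing is truncated. As `s` grows from `0` to `1`, this contracts `ℤ` to
`0`, moving each point by steps of size one. -/
noncomputable def intTruncate (x : ℤ) (s : unitInterval) : ℤ :=
  if s = 0 then x else max (-(⌊(s : ℝ)⁻¹⌋ - 1)) (min x (⌊(s : ℝ)⁻¹⌋ - 1))

/-- Joint continuity of the truncation. Near `s > 0` the truncation bound changes by at most
`1 ≤ m`; near `s = 0` no integer within `m` of `x` is truncated. -/
theorem eventually_abs_intTruncate_sub_le (s : unitInterval) {m : ℕ} (hm : 1 ≤ m) (x : ℤ) :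
    ∀ᶠ t in 𝓝 s, ∀ y, |y - x| ≤ m → |intTruncate y t - intTruncate x s| ≤ m := by
  by_cases hs : s = 0
  · subst hs
    have hpos : (0 : ℝ) < ((|x| + m + 1 : ℤ) : ℝ)⁻¹ := by
      have : (0 : ℤ) < |x| + m + 1 := by positivity
      exact inv_pos.2 (by exact_mod_cast this)
    have hev : ∀ᶠ t : unitInterval in 𝓝 0, (t : ℝ) < ((|x| + m + 1 : ℤ) : ℝ)⁻¹ :=
      (continuous_subtype_val.tendsto (0 : unitInterval)).eventually (gt_mem_nhds hpos)
    filter_upwards [hev] with t ht y hy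
    by_cases ht0 : t = 0
    · simpa [intTruncate, ht0] using hy
    · have htpos : (0 : ℝ) < t := unitInterval.pos_iff_ne_zero.2 ht0
      have hfl : |x| + m + 1 ≤ ⌊(t : ℝ)⁻¹⌋ :=
        Int.le_floor.2 ((lt_inv_comm₀ htpos (inv_pos.1 hpos)).1 ht).le
      simp only [intTruncate, ht0, if_false, if_true]
      rw [abs_le] at hy ⊢
      have h1 := neg_abs_le x
      have h2 := le_abs_self x
      omega
  · have hspos : (0 : ℝ) < s := unitInterval.pos_iff_ne_zero.2 hs
    have hc : ContinuousAt (fun t : unitInterval => (t : ℝ)⁻¹) s :=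
      continuous_subtype_val.continuousAt.inv₀ hspos.ne'
    have hs0 : ∀ᶠ t : unitInterval in 𝓝 s, t ≠ 0 := isOpen_ne.mem_nhds hs
    have hlow : ∀ᶠ t : unitInterval in 𝓝 s, ((⌊(s : ℝ)⁻¹⌋ - 1 : ℤ) : ℝ) < (t : ℝ)⁻¹ :=
      hc.eventually (lt_mem_nhds (by push_cast; linarith [Int.floor_le (s : ℝ)⁻¹]))
    have hupp : ∀ᶠ t : unitInterval in 𝓝 s, (t : ℝ)⁻¹ < ((⌊(s : ℝ)⁻¹⌋ + 1 : ℤ) : ℝ) :=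
      hc.eventually (gt_mem_nhds (by push_cast; exact Int.lt_floor_add_one _))
    filter_upwards [hs0, hlow, hupp] with t ht0 h1 h2 y hy
    have h1' := Int.le_floor.2 h1.le
    have h2' := Int.floor_lt.2 h2
    simp only [intTruncate, ht0, hs, if_false]
    rw [abs_le] at hy ⊢
    omega

/-- For `m ≥ 1`, truncation contracts `(ℤ, c_m)` to a point. -/
noncomputable def intClosureDeformation {m : ℕ} (hm : 1 ≤ m) :
    DiscreteDeformation (intClosure m) Unit where
  ret _ := ()
  inc _ := 0
  H := intTruncate
  ret_inc _ := rfl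
  H_zero x := by simp [intTruncate]
  H_one x := by
    simp only [intTruncate, one_ne_zero, if_false]
    simp
  ret_const _ _ _ _ := rfl
  continuous_H n σ := by
    rw [isContinuous_intClosure_iff]
    rintro ⟨x, s⟩
    have h1 := isContinuous_intClosure_iff.1 σ.2 x
    filter_upwards [(continuousAt_fst (p := (x, s))).eventually h1,
      (continuousAt_snd (p := (x, s))).eventually (eventually_abs_intTruncate_sub_le s hm (σ.1 x))]
      with p hp1 hp2
    exact hp2 _ hp1

/-- The closure space `(ℤ_n, c_0)` is discrete: its singular simplices are constant. -/
noncomputable def rootsOfUnityClosureZeroDeformation (n : ℕ) :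
    DiscreteDeformation (rootsOfUnityClosure n 0) (Fin n) where
  ret := id
  inc := id
  H x _ := x
  ret_inc _ := rfl
  H_zero _ := rfl
  H_one _ := rfl
  ret_const k σ x y := by
    have hlc : IsLocallyConstant σ.1 := (IsLocallyConstant.iff_eventually_eq _).2 fun x => by
      filter_upwards [isContinuous_rootsOfUnityClosure_iff.1 σ.2 x] with y hy
      obtain ⟨k, hk, hk0⟩ := cyclicDist_le_iff.1 hy
      obtain rfl : k = 0 := by simpa using hk0
      have h1 := Int.modEq_iff_dvd.1 hk
      rw [sub_zero] at h1
      have h2 := Int.eq_zero_of_abs_lt_dvd h1 (abs_lt.2 (by omega))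
      exact Fin.ext (by omega)
    exact hlc.apply_eq_of_preconnectedSpace x y
  continuous_H k σ := σ.2.comp (isContinuous_of_continuous continuous_fst)

/-! ### Homology of `ℤ_n` -/

theorem mainTheorem9 (n m k : ℕ) (hnm : 4 * m ≤ n) (hk : 2 ≤ k) :
    Subsingleton ((rootsOfUnityClosure n m).singularHomology k) := by
  rcases Nat.eq_zero_or_pos m with rfl | hm
  · exact (rootsOfUnityClosureZeroDeformation n).subsingleton_singularHomology (by omega)
  · have : NeZero n := ⟨by omega⟩
    obtain ⟨j, rfl⟩ := Nat.exists_eq_add_of_le' (show 1 ≤ k by omega)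
    have hS := shortExact_intToFin (n := n) (m := m) (by omega)
    have hZ : ∀ i ≠ 0, Limits.IsZero ((intClosure m).singularHomology i) := fun i hi =>
      have := (intClosureDeformation hm).subsingleton_singularHomology hi
      ModuleCat.isZero_of_subsingleton _
    -- `H_k(ℤ_n)` lies between `H_k(ℤ)` and `H_{k-1}(ℤ)`, both of which vanish as `k ≥ 2`
    have hex := hS.homology_exact₃ (j + 1) j (by simp)
    exact ModuleCat.subsingleton_of_isZero (hex.isZero_of_both_zeros
      ((hZ (j + 1) (by omega)).eq_of_src _ _) ((hZ j (by omega)).eq_of_tgt _ _))
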